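/- Let $T$ be a right or obtuse (non-degenerate) triangle in the Euclidean plane with side lengths $x,y,z$, and let $a$ be the area of its incircle. A finite collection of circles (of positive radii, repetitions allowed) can be packed into a shape $S$ if congruent copies of the corresponding closed disks can be placed inside $S$ with pairwise disjoint interiors. Then: 1. every finite collection of circles of combined area at most $a$ can be packed into the (closed) triangle $T$; 2. this bound is tight: for every $a'>a$ there is a finite collection of circles of combined area $a'$ that cannot be packed into $T$; 3. the critical density of $T$, i.e. the ratio between the largest number $A$ such that every finite collection of circles of combined area at most $A$ can be packed into $T$, and the area of $T$, equals $$\pi\sqrt{\frac{(x+y-z)(z+x-y)(y+z-x)}{(x+y+z)^3}}.$$ -/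

import Mathlib

open MeasureTheory

/-- The Euclidean plane. -/
abbrev Plane : Type := EuclideanSpace ℝ (Fin 2)

/-- The combined area of the circles with radii `r 0, …, r (n - 1)`. -/
noncomputable def combinedArea {n : ℕ} (r : Fin n → ℝ) : ℝ :=
  ∑ i, Real.pi * r i ^ 2

/-- The circles with radii `r 0, …, r (n - 1)` can be packed into the shape `S`: they can be placed
as closed disks inside `S` so that no two of them overlap (touching is allowed). -/
def CanBePackedInto {n : ℕ} (r : Fin n → ℝ) (S : Set Plane) : Prop :=
  ∃ c : Fin n → Plane, (∀ i, Metric.closedBall (c i) (r i) ⊆ S) ∧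
    ∀ i j, i ≠ j → Disjoint (Metric.ball (c i) (r i)) (Metric.ball (c j) (r j))

/-- Every finite collection of circles of combined area at most `a` can be packed into `S`. -/
def PacksAllOfArea (S : Set Plane) (a : ℝ) : Prop :=
  ∀ (n : ℕ) (r : Fin n → ℝ), (∀ i, 0 < r i) → combinedArea r ≤ a → CanBePackedInto r S

/-- `φ` is the critical density for packing circles into `S`: the ratio between the largest combined
area that can always be packed and the area of `S`. -/
def IsCriticalDensity (S : Set Plane) (φ : ℝ) : Prop :=
  ∃ a : ℝ, IsGreatest {a' : ℝ | PacksAllOfArea S a'} a ∧ φ = a / volume.real S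

/-! Put the longest side on the first axis and encode the angles there by the tangents `t`, `u` of
their halves. The angle at the apex is right or obtuse exactly when `t + u + t * u ≤ 1`, and the
base has length `R * (1 / t + 1 / u)`, where `R` is the inradius.

The packing is a recursion on the set of disks. The altitude from the apex cuts the triangle into
two right triangles whose incircle areas are in the ratio `(1 - t) ^ 2 : (1 - u) ^ 2`. The disks are
divided greedily in nearly this ratio, and each part is packed recursively into the right triangle
that has the acute angle of its corner and an incircle of exactly the area of the part. These two
triangles do not overlap (`feet_add_le`), but the one with too large a share may stick out of the
big triangle. This does no harm: greediness bounds the surplus by the smallest disk of that part,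
and disks that large cannot enter the protruding tip (`excess_le`,
`diskInTriangle_of_left_of_foot`). A single disk goes to the incenter.

Tightness holds because no disk larger than the incircle fits (`DiskInTriangle.radius_le`). The
critical density is then incircle area over triangle area, rewritten by Heron's formula. -/

/-! ### Split packing in half-angle coordinates -/

/-- The disk with centre `(x, y)` and radius `r` lies in the triangle with vertices `(0, 0)`,
`(L, 0)` and third vertex in the upper half plane, whose angles at the first two vertices have
half-angle tangents `t` and `u`. -/
def DiskInTriangle (t u L r x y : ℝ) : Prop :=
  r ≤ y ∧ r * (1 + t ^ 2) ≤ 2 * t * x - (1 - t ^ 2) * y ∧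
    r * (1 + u ^ 2) ≤ 2 * u * (L - x) - (1 - u ^ 2) * y

/-- The disks with radii `r i`, `i ∈ s`, can be packed into the triangle with inradius `R` and
half-angle tangents `t` and `u` at the vertices on the first coordinate axis. -/
def TrianglePacks {ι : Type*} (t u R : ℝ) (s : Finset ι) (r : ι → ℝ) : Prop :=
  ∃ x y : ι → ℝ, (∀ i ∈ s, DiskInTriangle t u (R * (1 / t + 1 / u)) (r i) (x i) (y i)) ∧
    ∀ i ∈ s, ∀ j ∈ s, i ≠ j → (r i + r j) ^ 2 ≤ (x i - x j) ^ 2 + (y i - y j) ^ 2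

/-- Greedy splitting: a finite family of weights can be divided into two parts whose sums are in the
ratio `f : g` up to an error bounded by the smallest weight of the larger part. -/
theorem exists_greedy_split {ι : Type*} [DecidableEq ι] (w : ι → ℝ) {f g : ℝ} (hf : 0 ≤ f)
    (hg : 0 ≤ g) (hw : ∀ i, 0 ≤ w i) (s : Finset ι) :
    ∃ s₁ s₂ : Finset ι, Disjoint s₁ s₂ ∧ s₁ ∪ s₂ = s ∧
      (∀ i ∈ s₁, g * ∑ j ∈ s₁, w j - f * ∑ j ∈ s₂, w j ≤ g * w i) ∧
      ∀ i ∈ s₂, f * ∑ j ∈ s₂, w j - g * ∑ j ∈ s₁, w j ≤ f * w i := by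
  induction s using Finset.induction_on_min_value w with
  | empty => exact ⟨∅, ∅, by simp⟩
  | insert m s hm hmin ih =>
    obtain ⟨s₁, s₂, hd, rfl, h₁, h₂⟩ := ih
    rw [Finset.mem_union, not_or] at hm
    -- The smallest weight is placed last, in a part that is not ahead, so that part ends up ahead
    -- by at most the scaled weight of `m`.
    rcases le_total (g * ∑ j ∈ s₁, w j) (f * ∑ j ∈ s₂, w j) with h | h
    · refine ⟨insert m s₁, s₂, Finset.disjoint_insert_left.2 ⟨hm.2, hd⟩,
        Finset.insert_union _ _ _, fun i hi => ?_, fun i hi => ?_⟩ <;>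
        rw [Finset.sum_insert hm.1]
      · have : w m ≤ w i := by
          rcases Finset.mem_insert.1 hi with rfl | hi
          · exact le_rfl
          · exact hmin i (Finset.mem_union_left _ hi)
        linarith [mul_le_mul_of_nonneg_left this hg]
      · linarith [mul_nonneg hg (hw m), h₂ i hi]
    · refine ⟨s₁, insert m s₂, Finset.disjoint_insert_right.2 ⟨hm.1, hd⟩,
        Finset.union_insert _ _ _, fun i hi => ?_, fun i hi => ?_⟩ <;>
        rw [Finset.sum_insert hm.2]
      · linarith [mul_nonneg hf (hw m), h₁ i hi]
      · have : w m ≤ w i := by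
          rcases Finset.mem_insert.1 hi with rfl | hi
          · exact le_rfl
          · exact hmin i (Finset.mem_union_right _ hi)
        linarith [mul_le_mul_of_nonneg_left this hf]

/-- The altitude feet of two right triangles cut off at the acute vertices do not cross. -/
theorem feet_add_le {t u R R₁ R₂ : ℝ} (ht : 0 < t) (hu : 0 < u) (htu : t + u + t * u ≤ 1)
    (hR : 0 ≤ R) (h : R₁ ^ 2 + R₂ ^ 2 ≤ R ^ 2) :
    R₁ * (1 + t) / t + R₂ * (1 + u) / u ≤ R * (1 / t + 1 / u) := by
  have e : R₁ * (1 + t) / t + R₂ * (1 + u) / u = (R₁ * ((1 + t) * u) + R₂ * ((1 + u) * t)) / (t * u) := by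
    field_simp
  have e' : R * (1 / t + 1 / u) = R * (t + u) / (t * u) := by field_simp; ring
  rw [e, e']
  have hk : ((1 + t) * u) ^ 2 + ((1 + u) * t) ^ 2 ≤ (t + u) ^ 2 := by
    nlinarith [mul_le_mul_of_nonneg_left htu (mul_pos ht hu).le]
  gcongr
  refine abs_le_of_sq_le_sq' ?_ (by positivity) |>.2
  calc _ ≤ (R₁ ^ 2 + R₂ ^ 2) * (((1 + t) * u) ^ 2 + ((1 + u) * t) ^ 2) := by
        nlinarith [sq_nonneg (R₁ * ((1 + u) * t) - R₂ * ((1 + t) * u))]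
    _ ≤ R ^ 2 * (t + u) ^ 2 := by gcongr
    _ = _ := by ring

/-- The altitude of the big triangle cuts off a right triangle of inradius `R * (1 - t) / (1 - t *
u)`, so the left side measures how far the triangle of inradius `R₁` exceeds it. By the split
hypothesis a large excess requires a large `r`. -/
theorem excess_le {t u R R₁ R₂ r : ℝ} (ht : 0 < t) (hu : 0 < u) (htu : t + u + t * u ≤ 1)
    (hR : 0 ≤ R) (hR₁ : 0 ≤ R₁) (hr : 0 ≤ r) (h : R₁ ^ 2 + R₂ ^ 2 ≤ R ^ 2)
    (hsplit : (1 - u) ^ 2 * R₁ ^ 2 - (1 - t) ^ 2 * R₂ ^ 2 ≤ (1 - u) ^ 2 * r ^ 2) :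
    R₁ * (1 - t * u) - R * (1 - t) ≤ r * t * (1 - u) := by
  have hp : 0 < 1 - t := by nlinarith
  have hq : 0 < 1 - u := by nlinarith
  have hw : 0 < 1 - t * u := by nlinarith
  rcases le_total (R₁ * (1 - t * u)) (R * (1 - t)) with hle | hge
  · have : 0 ≤ r * t * (1 - u) := by positivity
    linarith
  have hRR : R₁ ≤ R := abs_le_of_sq_le_sq' (by nlinarith) hR |>.2
  refine abs_le_of_sq_le_sq' ?_ (by positivity) |>.2
  have h1 : t ^ 2 * (((1 - t) ^ 2 + (1 - u) ^ 2) * R₁ ^ 2 - (1 - t) ^ 2 * R ^ 2)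
      ≤ (r * t * (1 - u)) ^ 2 := by
    have : ((1 - t) ^ 2 + (1 - u) ^ 2) * R₁ ^ 2 - (1 - t) ^ 2 * R ^ 2 ≤ (1 - u) ^ 2 * r ^ 2 := by
      nlinarith [mul_le_mul_of_nonneg_left h (sq_nonneg (1 - t))]
    nlinarith [mul_le_mul_of_nonneg_left this (sq_nonneg t)]
  refine le_trans ?_ h1
  -- The right side minus the left factors as `(R - R₁) * (k * R₁ - (1 - t) ^ 2 * (1 + t ^ 2) * R)`,
  -- since `1 - t * u - (1 - t) = t * (1 - u)`.
  set k := 2 * (1 - t * u) * (1 - t) - (1 - t) ^ 2 * (1 + t ^ 2) with hk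
  have h2 : (1 - t) * (1 + t ^ 2) ≤ (1 - t * u) * (1 - t ^ 2) := by
    have : 1 + t ^ 2 ≤ (1 - t * u) * (1 + t) := by nlinarith [mul_le_mul_of_nonneg_left htu ht.le]
    nlinarith [mul_le_mul_of_nonneg_left this hp.le]
  have h3 : (1 - t * u) * (1 - t) * (1 + t ^ 2) ≤ k := by
    rw [hk]
    nlinarith [mul_le_mul_of_nonneg_left h2 hp.le]
  have h4 : (1 - t) ^ 2 * (1 + t ^ 2) * R ≤ k * R₁ := by
    calc _ = (R * (1 - t)) * ((1 - t) * (1 + t ^ 2)) := by ring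
      _ ≤ (R₁ * (1 - t * u)) * ((1 - t) * (1 + t ^ 2)) := by gcongr
      _ = ((1 - t * u) * (1 - t) * (1 + t ^ 2)) * R₁ := by ring
      _ ≤ _ := by gcongr
  have h5 : 0 ≤ (R - R₁) * (k * R₁ - (1 - t) ^ 2 * (1 + t ^ 2) * R) :=
    mul_nonneg (sub_nonneg.2 hRR) (sub_nonneg.2 h4)
  rw [hk] at h5
  linarith

/-- A disk that meets the side conditions of the larger triangle at its first vertex, and lies to
the left of the foot of the altitude of the right triangle with inradius `R₁`, lies in the larger
triangle as soon as it is large compared to the excess. -/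
theorem diskInTriangle_of_left_of_foot {t u R R₁ R₂ r X Y : ℝ} (ht : 0 < t) (hu : 0 < u)
    (htu : t + u + t * u ≤ 1) (hR : 0 ≤ R) (hR₁ : 0 ≤ R₁) (hr : 0 ≤ r)
    (h : R₁ ^ 2 + R₂ ^ 2 ≤ R ^ 2)
    (hsplit : (1 - u) ^ 2 * R₁ ^ 2 - (1 - t) ^ 2 * R₂ ^ 2 ≤ (1 - u) ^ 2 * r ^ 2)
    (hY : r ≤ Y) (hside : r * (1 + t ^ 2) ≤ 2 * t * X - (1 - t ^ 2) * Y)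
    (hX : X + r ≤ R₁ * (1 + t) / t) : DiskInTriangle t u (R * (1 / t + 1 / u)) r X Y := by
  have hp : 0 < 1 - t := by nlinarith
  have hq : 0 < 1 - u := by nlinarith
  have hw : 0 < 1 - t * u := by nlinarith
  have hexc := excess_le ht hu htu hR hR₁ hr h hsplit
  refine ⟨hY, hside, ?_⟩
  rw [le_div_iff₀ ht] at hX
  have e : (1 - t ^ 2) * t *
      (2 * u * (R * (1 / t + 1 / u) - X) - (1 - u ^ 2) * Y - r * (1 + u ^ 2)) =
      (1 - t ^ 2) * (2 * R * (t + u)) - (1 - t ^ 2) * t * (2 * u * X + r * (1 + u ^ 2))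
        - t * (1 - u ^ 2) * ((1 - t ^ 2) * Y) := by
    field_simp
    ring
  have hu1 : 0 < 1 - u ^ 2 := by nlinarith
  have ht1 : 0 < 1 - t ^ 2 := by nlinarith
  -- The weights eliminate `Y` through the side condition and then `X` through the foot condition;
  -- what remains is a multiple of `excess_le`.
  have c1 := mul_le_mul_of_nonneg_left hside (show 0 ≤ t * (1 - u ^ 2) by positivity)
  have c2 := mul_le_mul_of_nonneg_left hX (show 0 ≤ 2 * (t + u) * (1 - t * u) by positivity)
  have c3 := mul_le_mul_of_nonneg_left hexc (show 0 ≤ 2 * (t + u) * (1 + t) by positivity)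
  have hnn : 0 ≤ (1 - t ^ 2) * t *
      (2 * u * (R * (1 / t + 1 / u) - X) - (1 - u ^ 2) * Y - r * (1 + u ^ 2)) := by
    rw [e]
    linarith
  linarith [nonneg_of_mul_nonneg_right hnn (mul_pos ht1 ht)]

/-- Reflection in the bisector of the first angle carries a disk of the right triangle with
inradius `R₁` into the larger triangle, provided the disk is large compared to the excess. -/
theorem DiskInTriangle.reflect {t u R R₁ R₂ r x y : ℝ} (ht : 0 < t) (hu : 0 < u)
    (htu : t + u + t * u ≤ 1) (hR : 0 ≤ R) (hR₁ : 0 ≤ R₁) (hr : 0 ≤ r)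
    (h : R₁ ^ 2 + R₂ ^ 2 ≤ R ^ 2)
    (hsplit : (1 - u) ^ 2 * R₁ ^ 2 - (1 - t) ^ 2 * R₂ ^ 2 ≤ (1 - u) ^ 2 * r ^ 2)
    (hd : DiskInTriangle t ((1 - t) / (1 + t)) (R₁ * (1 / t + 1 / ((1 - t) / (1 + t)))) r x y) :
    DiskInTriangle t u (R * (1 / t + 1 / u)) r
      (((1 - t ^ 2) * x + 2 * t * y) / (1 + t ^ 2)) ((2 * t * x - (1 - t ^ 2) * y) / (1 + t ^ 2)) ∧
    ((1 - t ^ 2) * x + 2 * t * y) / (1 + t ^ 2) + r ≤ R₁ * (1 + t) / t := by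
  have hp : 0 < 1 - t := by nlinarith
  obtain ⟨h1, h2, h3⟩ := hd
  have hX : ((1 - t ^ 2) * x + 2 * t * y) / (1 + t ^ 2) + r ≤ R₁ * (1 + t) / t := by
    -- The second base angle is complementary to the first, so the reflection makes its other side
    -- vertical, through the foot.
    have e : 2 * ((1 - t) / (1 + t)) * (R₁ * (1 / t + 1 / ((1 - t) / (1 + t))) - x) -
        (1 - ((1 - t) / (1 + t)) ^ 2) * y - r * (1 + ((1 - t) / (1 + t)) ^ 2) =
        2 * (1 + t ^ 2) / (1 + t) ^ 2 *
          (R₁ * (1 + t) / t - (((1 - t ^ 2) * x + 2 * t * y) / (1 + t ^ 2) + r)) := by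
      field_simp
      ring
    have := e.symm.trans_ge (sub_nonneg.2 h3)
    exact sub_nonneg.1 (nonneg_of_mul_nonneg_right this (by positivity))
  refine ⟨diskInTriangle_of_left_of_foot ht hu htu hR hR₁ hr h hsplit ?_ ?_ hX, hX⟩
  · rwa [le_div_iff₀ (by positivity)]
  · have e : 2 * t * (((1 - t ^ 2) * x + 2 * t * y) / (1 + t ^ 2)) -
        (1 - t ^ 2) * ((2 * t * x - (1 - t ^ 2) * y) / (1 + t ^ 2)) = y * (1 + t ^ 2) := by
      field_simp
      ring
    rw [e]
    gcongr

theorem TrianglePacks.symm {ι : Type*} {t u R : ℝ} {s : Finset ι} {r : ι → ℝ}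
    (h : TrianglePacks t u R s r) : TrianglePacks u t R s r := by
  obtain ⟨x, y, h, hd⟩ := h
  refine ⟨fun i => R * (1 / t + 1 / u) - x i, y, fun i hi => ?_, fun i hi j hj hij => ?_⟩
  · obtain ⟨h1, h2, h3⟩ := h i hi
    refine ⟨h1, ?_, ?_⟩
    · linarith
    · rw [add_comm (1 / u)]; linarith
  · have := hd i hi j hj hij
    linarith

theorem TrianglePacks.union {ι : Type*} [DecidableEq ι] {t u R R₁ R₂ : ℝ} {s₁ s₂ : Finset ι}
    {r : ι → ℝ} (ht : 0 < t) (hu : 0 < u) (htu : t + u + t * u ≤ 1) (hR : 0 ≤ R) (hR₁ : 0 ≤ R₁)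
    (hR₂ : 0 ≤ R₂) (h : R₁ ^ 2 + R₂ ^ 2 ≤ R ^ 2) (hr : ∀ i ∈ s₁ ∪ s₂, 0 ≤ r i)
    (hsplit₁ : ∀ i ∈ s₁, (1 - u) ^ 2 * R₁ ^ 2 - (1 - t) ^ 2 * R₂ ^ 2 ≤ (1 - u) ^ 2 * r i ^ 2)
    (hsplit₂ : ∀ i ∈ s₂, (1 - t) ^ 2 * R₂ ^ 2 - (1 - u) ^ 2 * R₁ ^ 2 ≤ (1 - t) ^ 2 * r i ^ 2)
    (h₁ : TrianglePacks t ((1 - t) / (1 + t)) R₁ s₁ r)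
    (h₂ : TrianglePacks u ((1 - u) / (1 + u)) R₂ s₂ r) :
    TrianglePacks t u R (s₁ ∪ s₂) r := by
  obtain ⟨x₁, y₁, hin₁, hd₁⟩ := h₁
  obtain ⟨x₂, y₂, hin₂, hd₂⟩ := h₂
  have key₁ := fun i hi => DiskInTriangle.reflect ht hu htu hR hR₁
    (hr i (Finset.mem_union_left _ hi)) h (hsplit₁ i hi) (hin₁ i hi)
  have key₂ := fun i hi => DiskInTriangle.reflect hu ht (by linarith) hR hR₂
    (hr i (Finset.mem_union_right _ hi)) (by linarith) (hsplit₂ i hi) (hin₂ i hi)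
  have hfeet := feet_add_le ht hu htu hR h
  set L := R * (1 / t + 1 / u) with hL
  have hL' : R * (1 / u + 1 / t) = L := by rw [hL, add_comm (1 / u)]
  have iso : ∀ t x y x' y' : ℝ, (((1 - t ^ 2) * x + 2 * t * y) / (1 + t ^ 2) -
      ((1 - t ^ 2) * x' + 2 * t * y') / (1 + t ^ 2)) ^ 2 +
      ((2 * t * x - (1 - t ^ 2) * y) / (1 + t ^ 2) -
      (2 * t * x' - (1 - t ^ 2) * y') / (1 + t ^ 2)) ^ 2 = (x - x') ^ 2 + (y - y') ^ 2 := by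
    intro t x y x' y'
    field_simp
    ring
  have hmem : ∀ i ∈ s₁ ∪ s₂, i ∉ s₁ → i ∈ s₂ := fun i hi hi' =>
    (Finset.mem_union.1 hi).resolve_left hi'
  -- The second part is built at the origin like the first and then mirrored by `x ↦ L - x` into the
  -- other corner.
  refine ⟨fun i => if i ∈ s₁ then ((1 - t ^ 2) * x₁ i + 2 * t * y₁ i) / (1 + t ^ 2) else
      L - ((1 - u ^ 2) * x₂ i + 2 * u * y₂ i) / (1 + u ^ 2),
    fun i => if i ∈ s₁ then (2 * t * x₁ i - (1 - t ^ 2) * y₁ i) / (1 + t ^ 2) else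
      (2 * u * x₂ i - (1 - u ^ 2) * y₂ i) / (1 + u ^ 2), fun i hi => ?_, fun i hi j hj hij => ?_⟩
  · by_cases hi₁ : i ∈ s₁
    · simp only [hi₁, if_true]
      exact (key₁ i hi₁).1
    · simp only [hi₁, if_false]
      obtain ⟨⟨c1, c2, c3⟩, -⟩ := key₂ i (hmem i hi hi₁)
      rw [hL'] at c3
      refine ⟨c1, c3, ?_⟩
      linarith
  · by_cases hi₁ : i ∈ s₁ <;> by_cases hj₁ : j ∈ s₁ <;> simp only [hi₁, hj₁, if_true, if_false]
    · rw [iso]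
      exact hd₁ i hi₁ j hj₁ hij
    · have a := (key₁ i hi₁).2
      have b := (key₂ j (hmem j hj hj₁)).2
      rw [← neg_sq (_ - (L - _))]
      refine le_add_of_le_of_nonneg
        (pow_le_pow_left₀ (add_nonneg (hr i hi) (hr j hj)) ?_ 2) (sq_nonneg _)
      linarith
    · have a := (key₁ j hj₁).2
      have b := (key₂ i (hmem i hi hi₁)).2
      refine le_add_of_le_of_nonneg
        (pow_le_pow_left₀ (add_nonneg (hr i hi) (hr j hj)) ?_ 2) (sq_nonneg _)
      linarith
    · have := hd₂ i (hmem i hi hi₁) j (hmem j hj hj₁) hij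
      rw [← iso u] at this
      linarith

/-- The incircle of the triangle contains every disk of smaller radius around its centre. -/
theorem diskInTriangle_incenter {t u R r : ℝ} (ht : 0 < t) (hu : 0 < u) (hr : r ≤ R) :
    DiskInTriangle t u (R * (1 / t + 1 / u)) r (R / t) R := by
  refine ⟨hr, ?_, ?_⟩
  · have : 2 * t * (R / t) - (1 - t ^ 2) * R = R * (1 + t ^ 2) := by field_simp; ring
    rw [this]
    gcongr
  · have : 2 * u * (R * (1 / t + 1 / u) - R / t) - (1 - u ^ 2) * R = R * (1 + u ^ 2) := by
      field_simp; ring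
    rw [this]
    gcongr

/-- Disks whose squared radii sum to at most `R ^ 2` can be packed into every right or obtuse
triangle with inradius `R`. -/
theorem trianglePacks_of_sum_sq_le {ι : Type*} [DecidableEq ι] (r : ι → ℝ) (hr : ∀ i, 0 < r i)
    (s : Finset ι) : ∀ {t u R : ℝ}, 0 < t → 0 < u → t + u + t * u ≤ 1 → 0 ≤ R →
      ∑ i ∈ s, r i ^ 2 ≤ R ^ 2 → TrianglePacks t u R s r := by
  induction s using Finset.strongInduction with
  | H s ih =>
    intro t u R ht hu htu hR hsum
    rcases Nat.lt_or_ge 1 s.card with hcard | hcard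
    · have hp : 0 < 1 - t := by nlinarith
      have hq : 0 < 1 - u := by nlinarith
      obtain ⟨s₁, s₂, hd, rfl, h₁, h₂⟩ := exists_greedy_split (fun i => r i ^ 2)
        (sq_nonneg (1 - t)) (sq_nonneg (1 - u)) (fun i => sq_nonneg _) s
      -- If one part were empty, the greedy bound would make the whole sum at most each single
      -- weight, impossible for two positive weights. Hence both parts are proper subsets.
      have small : ∀ s' : Finset ι, ∀ c : ℝ, 0 < c →
          (∀ i ∈ s', c * ∑ j ∈ s', r j ^ 2 ≤ c * r i ^ 2) → s'.card ≤ 1 := by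
        intro s' c hc h
        by_contra! hlt
        obtain ⟨i, hi, j, hj, hij⟩ := Finset.one_lt_card.1 hlt
        have h1 := le_of_mul_le_mul_left (h i hi) hc
        have h2 : ∑ k ∈ {i, j}, r k ^ 2 ≤ ∑ k ∈ s', r k ^ 2 :=
          Finset.sum_le_sum_of_subset_of_nonneg
            (by simp [Finset.insert_subset_iff, hi, hj]) (fun _ _ _ => sq_nonneg _)
        rw [Finset.sum_pair hij] at h2
        linarith [pow_pos (hr j) 2]
      have hne₁ : s₁.Nonempty := by
        by_contra hne
        rw [Finset.not_nonempty_iff_eq_empty] at hne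
        subst hne
        rw [Finset.empty_union] at hcard
        exact absurd (small s₂ _ (pow_pos hp 2) (by simpa using h₂)) (by omega)
      have hne₂ : s₂.Nonempty := by
        by_contra hne
        rw [Finset.not_nonempty_iff_eq_empty] at hne
        subst hne
        rw [Finset.union_empty] at hcard
        exact absurd (small s₁ _ (pow_pos hq 2) (by simpa using h₁)) (by omega)
      have hsub₁ : s₁ ⊂ s₁ ∪ s₂ := by
        refine Finset.ssubset_iff_subset_ne.2 ⟨Finset.subset_union_left, fun e => ?_⟩
        obtain ⟨i, hi⟩ := hne₂
        exact Finset.disjoint_left.1 hd (e ▸ Finset.mem_union_right _ hi) hi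
      have hsub₂ : s₂ ⊂ s₁ ∪ s₂ := by
        refine Finset.ssubset_iff_subset_ne.2 ⟨Finset.subset_union_right, fun e => ?_⟩
        obtain ⟨i, hi⟩ := hne₁
        exact Finset.disjoint_left.1 hd hi (e ▸ Finset.mem_union_left _ hi)
      have nn : ∀ s' : Finset ι, 0 ≤ ∑ i ∈ s', r i ^ 2 :=
        fun s' => Finset.sum_nonneg fun _ _ => sq_nonneg _
      have right : ∀ v : ℝ, 0 < v → v + (1 - v) / (1 + v) + v * ((1 - v) / (1 + v)) ≤ 1 := by
        intro v hv
        apply le_of_eq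
        field_simp
        ring
      refine TrianglePacks.union (R₁ := √(∑ i ∈ s₁, r i ^ 2)) (R₂ := √(∑ i ∈ s₂, r i ^ 2)) ht hu htu
        hR (Real.sqrt_nonneg _) (Real.sqrt_nonneg _) ?_ (fun i _ => (hr i).le) ?_ ?_ ?_ ?_
      · rw [Real.sq_sqrt (nn _), Real.sq_sqrt (nn _), ← Finset.sum_union hd]
        exact hsum
      · rwa [Real.sq_sqrt (nn _), Real.sq_sqrt (nn _)]
      · rwa [Real.sq_sqrt (nn _), Real.sq_sqrt (nn _)]
      · exact ih s₁ hsub₁ ht (by positivity) (right t ht) (Real.sqrt_nonneg _)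
          (Real.sq_sqrt (nn _)).ge
      · exact ih s₂ hsub₂ hu (by positivity) (right u hu) (Real.sqrt_nonneg _)
          (Real.sq_sqrt (nn _)).ge
    · refine ⟨fun _ => R / t, fun _ => R, fun i hi => diskInTriangle_incenter ht hu ?_,
        fun i hi j hj hij => absurd (Finset.card_le_one.1 hcard i hi j hj) hij⟩
      refine abs_le_of_sq_le_sq' (le_trans ?_ hsum) hR |>.2
      exact Finset.single_le_sum (f := fun i => r i ^ 2) (fun _ _ => sq_nonneg _) hi

/-! ### Inradius, area and disk containment in coordinates -/

/-- Twice the signed area of a triangle in the plane. -/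
def doubleSignedArea (p q s : Plane) : ℝ :=
  (q 0 - p 0) * (s 1 - p 1) - (q 1 - p 1) * (s 0 - p 0)

theorem Plane.dist_sq (p q : Plane) : dist p q ^ 2 = (p 0 - q 0) ^ 2 + (p 1 - q 1) ^ 2 := by
  rw [EuclideanSpace.dist_sq_eq, Fin.sum_univ_two, Real.dist_eq, Real.dist_eq, sq_abs, sq_abs]

theorem Plane.inner_eq (p q : Plane) : inner ℝ p q = p 0 * q 0 + p 1 * q 1 := by
  simp [PiLp.inner_apply, Fin.sum_univ_two, mul_comm]

theorem Affine.Triangle.height_mul_dist (T : Affine.Triangle ℝ Plane) {i j k : Fin 3}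
    (hijk : ({i}ᶜ : Set (Fin 3)) = {j, k}) (hjk : j ≠ k) :
    T.height i * dist (T.points j) (T.points k) =
      |doubleSignedArea (T.points i) (T.points j) (T.points k)| := by
  set A := T.points i
  set B := T.points j
  set C := T.points k
  have hBC : 0 < dist B C := dist_pos.2 fun h => hjk (T.independent.injective h)
  set τ := inner ℝ (A - B) (C - B) / dist B C ^ 2 with hτ
  have hd := Plane.dist_sq B C
  have hin : inner ℝ (A - B) (C - B) = (A 0 - B 0) * (C 0 - B 0) + (A 1 - B 1) * (C 1 - B 1) := by
    rw [Plane.inner_eq]; rfl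
  have hτ' : τ * dist B C ^ 2 = (A 0 - B 0) * (C 0 - B 0) + (A 1 - B 1) * (C 1 - B 1) := by
    rw [← hin, hτ, div_mul_cancel₀ _ (pow_pos hBC 2).ne']
  have hspan : affineSpan ℝ (Set.range (T.faceOpposite i).points) = line[ℝ, B, C] := by
    rw [Affine.Simplex.range_faceOpposite_points, hijk, Set.image_pair]
  have hfoot : T.altitudeFoot i = AffineMap.lineMap B C τ := by
    rw [Affine.Simplex.altitudeFoot, Affine.Simplex.orthogonalProjectionSpan]
    rw [EuclideanGeometry.coe_orthogonalProjection_eq_iff_mem]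
    rw [hspan]
    refine ⟨AffineMap.lineMap_mem_affineSpan_pair _ _ _, ?_⟩
    rw [direction_affineSpan, vectorSpan_pair_rev, Submodule.mem_orthogonal_singleton_iff_inner_right,
      Plane.inner_eq]
    simp only [AffineMap.lineMap_apply, vsub_eq_sub, vadd_eq_add, PiLp.sub_apply, PiLp.add_apply,
      PiLp.smul_apply, smul_eq_mul]
    rw [hd] at hτ'
    linear_combination -hτ'
  have hh : T.height i = dist A (AffineMap.lineMap B C τ) := by
    rw [Affine.Simplex.height, hfoot]
  rw [← abs_of_nonneg (mul_nonneg (T.height_pos i).le hBC.le), ← sq_eq_sq_iff_abs_eq_abs, mul_pow,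
    hh, hd, Plane.dist_sq]
  simp only [AffineMap.lineMap_apply, vsub_eq_sub, vadd_eq_add, PiLp.sub_apply, PiLp.add_apply,
    PiLp.smul_apply, smul_eq_mul, doubleSignedArea]
  rw [hd] at hτ'
  linear_combination (τ * ((B 0 - C 0) ^ 2 + (B 1 - C 1) ^ 2) -
    ((A 0 - B 0) * (C 0 - B 0) + (A 1 - B 1) * (C 1 - B 1))) * hτ'

/-- The reciprocal of the inradius is the sum of the reciprocal heights, and each reciprocal height
is its side over the doubled area. -/
theorem Affine.Triangle.inradius_mul_perimeter (T : Affine.Triangle ℝ Plane) :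
    T.inradius * (dist (T.points 1) (T.points 2) + dist (T.points 2) (T.points 0) +
      dist (T.points 0) (T.points 1)) =
      |doubleSignedArea (T.points 0) (T.points 1) (T.points 2)| := by
  have h0 := T.height_mul_dist (i := 0) (j := 1) (k := 2) (by ext x; fin_cases x <;> simp) (by decide)
  have h1 := T.height_mul_dist (i := 1) (j := 2) (k := 0) (by ext x; fin_cases x <;> simp) (by decide)
  have h2 := T.height_mul_dist (i := 2) (j := 0) (k := 1) (by ext x; fin_cases x <;> simp) (by decide)
  have e1 : doubleSignedArea (T.points 1) (T.points 2) (T.points 0) =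
      doubleSignedArea (T.points 0) (T.points 1) (T.points 2) := by
    simp only [doubleSignedArea]; ring
  have e2 : doubleSignedArea (T.points 2) (T.points 0) (T.points 1) =
      doubleSignedArea (T.points 0) (T.points 1) (T.points 2) := by
    simp only [doubleSignedArea]; ring
  rw [e1] at h1
  rw [e2] at h2
  have p0 := T.height_pos 0
  have p1 := T.height_pos 1
  have p2 := T.height_pos 2
  set D := |doubleSignedArea (T.points 0) (T.points 1) (T.points 2)|
  rw [T.inradius_eq_abs_inv_sum]
  have hs : ∑ i, T.excenterWeightsUnnorm ∅ i = (T.height 0)⁻¹ + (T.height 1)⁻¹ + (T.height 2)⁻¹ := by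
    simp only [Affine.Simplex.excenterWeightsUnnorm_empty_apply]
    exact Fin.sum_univ_three _
  rw [hs]
  rw [abs_of_pos (by positivity), inv_mul_eq_iff_eq_mul₀ (by positivity), add_mul, add_mul]
  nth_rw 1 [← h0]
  nth_rw 1 [← h1]
  nth_rw 1 [← h2]
  rw [inv_mul_cancel_left₀ p0.ne', inv_mul_cancel_left₀ p1.ne', inv_mul_cancel_left₀ p2.ne']

theorem Affine.Triangle.mem_closedInterior_iff (T : Affine.Triangle ℝ Plane) {L c h : ℝ}
    (hL : 0 < L) (hh : 0 < h) (h0 : T.points 0 = !₂[0, 0]) (h1 : T.points 1 = !₂[L, 0])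
    (h2 : T.points 2 = !₂[c, h]) (P : Plane) :
    P ∈ T.closedInterior ↔ 0 ≤ P 1 ∧ 0 ≤ h * P 0 - c * P 1 ∧ 0 ≤ h * (L - P 0) - (L - c) * P 1 := by
  have key : ∀ w : Fin 3 → ℝ, ∑ i, w i = 1 →
      (Finset.univ.affineCombination ℝ T.points w = P ↔
        P 0 = w 1 * L + w 2 * c ∧ P 1 = w 2 * h) := by
    intro w hw
    rw [Finset.affineCombination_eq_linear_combination _ _ _ hw, PiLp.ext_iff, Fin.forall_fin_two]
    simp [Fin.sum_univ_three, h0, h1, h2, eq_comm]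
  constructor
  · rintro ⟨w, hw, hw01, hP⟩
    obtain ⟨e0, e1⟩ := (key w hw).1 hP
    rw [Fin.sum_univ_three] at hw
    have w0 := (hw01 0).1
    have w1 := (hw01 1).1
    have w2 := (hw01 2).1
    refine ⟨by rw [e1]; positivity, ?_, ?_⟩
    · have : h * P 0 - c * P 1 = h * L * w 1 := by rw [e0, e1]; ring
      rw [this]; positivity
    · have : h * (L - P 0) - (L - c) * P 1 = h * L * w 0 := by
        rw [e0, e1]; linear_combination -h * L * hw
      rw [this]; positivity
  · rintro ⟨c0, c1, c2⟩
    have hLh : 0 < h * L := by positivity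
    have hsum : (h * (L - P 0) - (L - c) * P 1) / (h * L) + (h * P 0 - c * P 1) / (h * L) +
        P 1 / h = 1 := by
      field_simp
      ring
    have n0 := div_nonneg c2 hLh.le
    have n1 := div_nonneg c1 hLh.le
    have n2 := div_nonneg c0 hh.le
    have hw : ∑ i, (![(h * (L - P 0) - (L - c) * P 1) / (h * L), (h * P 0 - c * P 1) / (h * L),
        P 1 / h] : Fin 3 → ℝ) i = 1 := by
      rw [Fin.sum_univ_three]
      exact hsum
    refine ⟨_, hw, ?_, (key _ hw).2 ⟨?_, ?_⟩⟩
    · intro i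
      fin_cases i
      · exact ⟨n0, by simp only [Fin.zero_eta, Matrix.cons_val_zero]; linarith⟩
      · exact ⟨n1, by simp only [Fin.mk_one, Matrix.cons_val_one, Matrix.cons_val_zero]; linarith⟩
      · exact ⟨n2, by simp only [Fin.reduceFinMk, Matrix.cons_val]; linarith⟩
    · simp only [Matrix.cons_val]
      field_simp
      ring
    · simp only [Matrix.cons_val]
      field_simp

theorem volume_triangle {L c h : ℝ} (hL : 0 < L) (hh : 0 < h) :
    volume.real {P : Plane | 0 ≤ P 1 ∧ 0 ≤ h * P 0 - c * P 1 ∧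
      0 ≤ h * (L - P 0) - (L - c) * P 1} = L * h / 2 := by
  -- Coordinates are swapped so that Fubini slices horizontally; the slice at height `y` is an
  -- interval of length `L * (1 - y / h)`.
  set S : Set (ℝ × ℝ) := {p | 0 ≤ p.1 ∧ 0 ≤ h * p.2 - c * p.1 ∧
    0 ≤ h * (L - p.2) - (L - c) * p.1} with hS
  have hSm : MeasurableSet S := by
    refine IsClosed.measurableSet ?_
    exact (isClosed_le (g := fun p : ℝ × ℝ => p.1) continuous_const (by fun_prop)).inter
      ((isClosed_le (g := fun p : ℝ × ℝ => h * p.2 - c * p.1) continuous_const (by fun_prop)).inter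
        (isClosed_le (g := fun p : ℝ × ℝ => h * (L - p.2) - (L - c) * p.1) continuous_const
          (by fun_prop)))
  have hmp : MeasurePreserving (fun P : Plane => (P 1, P 0)) volume volume :=
    Measure.measurePreserving_swap.comp
      ((volume_preserving_finTwoArrow ℝ).comp (PiLp.volume_preserving_ofLp (Fin 2)))
  have hpre : {P : Plane | 0 ≤ P 1 ∧ 0 ≤ h * P 0 - c * P 1 ∧ 0 ≤ h * (L - P 0) - (L - c) * P 1} =
      (fun P : Plane => (P 1, P 0)) ⁻¹' S := rfl
  have hsec : ∀ y, volume (Prod.mk y ⁻¹' S) =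
      (Set.Icc 0 h).indicator (fun y => ENNReal.ofReal (L * (1 - y / h))) y := by
    intro y
    by_cases hy : y ∈ Set.Icc 0 h
    · rw [Set.indicator_of_mem hy]
      have : Prod.mk y ⁻¹' S = Set.Icc (c * y / h) (L - (L - c) * y / h) := by
        ext x
        simp only [hS, Set.mem_preimage, Set.mem_ofPred_eq, Set.mem_Icc, hy.1, true_and]
        rw [div_le_iff₀ hh, le_sub_comm (a := x), div_le_iff₀ hh]
        constructor <;> rintro ⟨h1, h2⟩ <;> constructor <;> linarith
      rw [this, Real.volume_Icc]
      congr 1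
      field_simp
      ring
    · rw [Set.indicator_of_notMem hy]
      have : Prod.mk y ⁻¹' S = ∅ := by
        ext x
        simp only [hS, Set.mem_preimage, Set.mem_ofPred_eq, Set.mem_empty_iff_false, iff_false]
        rintro ⟨h1, h2, h3⟩
        exact hy ⟨h1, le_of_mul_le_mul_left (by linarith : L * y ≤ L * h) hL⟩
      rw [this, measure_empty]
  have hint : ∫ y in (0 : ℝ)..h, L * (1 - y / h) = L * h / 2 := by
    rw [intervalIntegral.integral_const_mul, intervalIntegral.integral_sub (by simp) (by simp),
      intervalIntegral.integral_div, integral_id]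
    simp
    field_simp
    ring
  rw [measureReal_def, hpre, hmp.measure_preimage hSm.nullMeasurableSet, Measure.volume_eq_prod,
    Measure.prod_apply hSm]
  simp_rw [hsec]
  rw [lintegral_indicator measurableSet_Icc, ← ofReal_integral_eq_lintegral_ofReal,
    integral_Icc_eq_integral_Ioc, ← intervalIntegral.integral_of_le hh.le, hint,
    ENNReal.toReal_ofReal (by positivity)]
  · exact (Continuous.integrableOn_Icc (by fun_prop))
  · refine (ae_restrict_iff' measurableSet_Icc).2 (Filter.Eventually.of_forall fun y hy => ?_)
    have : y / h ≤ 1 := (div_le_one hh).2 hy.2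
    exact mul_nonneg hL.le (sub_nonneg.2 this)

/-- A disk lies in a triangle in normal position if and only if its centre is far enough from the
sides. -/
theorem Affine.Triangle.closedBall_subset_closedInterior_iff (T : Affine.Triangle ℝ Plane)
    {t u L h : ℝ} (ht : 0 < t) (hu : 0 < u) (hL : 0 < L) (hh : 0 < h)
    (hLtu : L = h * ((1 - t ^ 2) / (2 * t)) + h * ((1 - u ^ 2) / (2 * u)))
    (h0 : T.points 0 = !₂[0, 0]) (h1 : T.points 1 = !₂[L, 0])
    (h2 : T.points 2 = !₂[h * ((1 - t ^ 2) / (2 * t)), h]) (P : Plane) {r : ℝ} (hr : 0 ≤ r) :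
    Metric.closedBall P r ⊆ T.closedInterior ↔ DiskInTriangle t u L r (P 0) (P 1) := by
  have hmem : ∀ Q : Plane, Q ∈ T.closedInterior ↔ 0 ≤ Q 1 ∧ 0 ≤ 2 * t * Q 0 - (1 - t ^ 2) * Q 1 ∧
      0 ≤ 2 * u * (L - Q 0) - (1 - u ^ 2) * Q 1 := by
    intro Q
    rw [T.mem_closedInterior_iff hL hh h0 h1 h2]
    have e1 : h * Q 0 - h * ((1 - t ^ 2) / (2 * t)) * Q 1 =
        h / (2 * t) * (2 * t * Q 0 - (1 - t ^ 2) * Q 1) := by field_simp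
    have e2 : h * (L - Q 0) - (L - h * ((1 - t ^ 2) / (2 * t))) * Q 1 =
        h / (2 * u) * (2 * u * (L - Q 0) - (1 - u ^ 2) * Q 1) := by
      have : L - h * ((1 - t ^ 2) / (2 * t)) = h * ((1 - u ^ 2) / (2 * u)) := by
        rw [hLtu]; ring
      rw [this]
      field_simp
    rw [e1, e2, mul_nonneg_iff_of_pos_left (by positivity),
      mul_nonneg_iff_of_pos_left (by positivity)]
  have ball : ∀ a b : ℝ, a ^ 2 + b ^ 2 = 1 → !₂[P 0 + r * a, P 1 + r * b] ∈ Metric.closedBall P r := by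
    intro a b hab
    rw [Metric.mem_closedBall]
    refine abs_le_of_sq_le_sq' ?_ hr |>.2
    rw [Plane.dist_sq]
    simp only [Matrix.cons_val_zero, Matrix.cons_val_one]
    apply le_of_eq
    linear_combination r ^ 2 * hab
  constructor
  · intro hsub
    -- The test points are the extreme points of the disk along the outer normals of the three
    -- sides.
    have k0 := ((hmem _).1 (hsub (ball 0 (-1) (by norm_num)))).1
    have k1 := ((hmem _).1 (hsub (ball (-(2 * t) / (1 + t ^ 2)) ((1 - t ^ 2) / (1 + t ^ 2))
      (by field_simp; ring)))).2.1
    have k2 := ((hmem _).1 (hsub (ball (2 * u / (1 + u ^ 2)) ((1 - u ^ 2) / (1 + u ^ 2))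
      (by field_simp; ring)))).2.2
    simp only [Matrix.cons_val_zero, Matrix.cons_val_one] at k0 k1 k2
    refine ⟨by linarith, ?_, ?_⟩
    · refine sub_nonneg.1 (k1.trans_eq ?_)
      field_simp
      ring
    · refine sub_nonneg.1 (k2.trans_eq ?_)
      field_simp
      ring
  · rintro ⟨d0, d1, d2⟩ Q hQ
    rw [Metric.mem_closedBall] at hQ
    have hQ2 : (Q 0 - P 0) ^ 2 + (Q 1 - P 1) ^ 2 ≤ r ^ 2 := by
      rw [← Plane.dist_sq]
      exact pow_le_pow_left₀ dist_nonneg hQ 2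
    have lin : ∀ a b m : ℝ, a ^ 2 + b ^ 2 = m ^ 2 → 0 ≤ m →
        -(r * m) ≤ a * (Q 0 - P 0) + b * (Q 1 - P 1) := by
      intro a b m hm hm0
      refine abs_le_of_sq_le_sq' ?_ (by positivity) |>.1
      calc _ ≤ (a ^ 2 + b ^ 2) * ((Q 0 - P 0) ^ 2 + (Q 1 - P 1) ^ 2) := by
            nlinarith [sq_nonneg (a * (Q 1 - P 1) - b * (Q 0 - P 0))]
        _ ≤ (a ^ 2 + b ^ 2) * r ^ 2 := by gcongr
        _ = _ := by rw [hm]; ring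
    have l0 := lin 0 1 1 (by norm_num) (by norm_num)
    have l1 := lin (2 * t) (-(1 - t ^ 2)) (1 + t ^ 2) (by ring) (by positivity)
    have l2 := lin (-(2 * u)) (-(1 - u ^ 2)) (1 + u ^ 2) (by ring) (by positivity)
    refine (hmem Q).2 ⟨by linarith, by linarith, by linarith⟩

/-- Weighting the distances from a point to the sides by the side lengths gives twice the area, that
is `R` times the perimeter. The weights below are proportional to the side lengths. -/
theorem DiskInTriangle.radius_le {t u R r x y : ℝ} (ht : 0 < t) (hu : 0 < u) (ht1 : t < 1)
    (hu1 : u < 1) (h : DiskInTriangle t u (R * (1 / t + 1 / u)) r x y) : r ≤ R := by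
  obtain ⟨h0, h1, h2⟩ := h
  have e1 : 2 * u * (R * (1 / t + 1 / u) - x) * t = 2 * R * (t + u) - 2 * t * u * x := by
    field_simp
    ring
  have a1 := mul_le_mul_of_nonneg_left h1 hu.le
  have a2 := mul_le_mul_of_nonneg_left h2 ht.le
  have hc : 0 ≤ u * (1 - t ^ 2) + t * (1 - u ^ 2) := by
    have : 0 ≤ 1 - t ^ 2 := by nlinarith
    have : 0 ≤ 1 - u ^ 2 := by nlinarith
    positivity
  have a0 := mul_le_mul_of_nonneg_left h0 hc
  have : (t + u) * r ≤ (t + u) * R := by linarith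
  exact le_of_mul_le_mul_left this (by positivity)

/-! ### Congruence and normal position -/

theorem CanBePackedInto.of_image {n : ℕ} {r : Fin n → ℝ} {S : Set Plane} (g : Plane ≃ᵢ Plane)
    (h : CanBePackedInto r (g '' S)) : CanBePackedInto r S := by
  obtain ⟨c, hc, hd⟩ := h
  refine ⟨fun i => g.symm (c i), fun i => ?_, fun i j hij => ?_⟩
  · rw [← g.preimage_closedBall, ← g.injective.preimage_image S]
    exact Set.preimage_mono (hc i)
  · rw [← g.preimage_ball, ← g.preimage_ball]
    exact (hd i j hij).preimage _

theorem AffineIsometryEquiv.measurePreserving_plane (f : Plane ≃ᵃⁱ[ℝ] Plane) :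
    MeasurePreserving f volume volume := by
  have h : (f : Plane → Plane) = fun x => f.linearIsometryEquiv x + f 0 := by
    ext1 x
    simpa using f.map_vadd 0 x
  rw [h]
  exact (measurePreserving_add_right volume (f 0)).comp f.linearIsometryEquiv.measurePreserving

theorem volume_image_affineIsometryEquiv (f : Plane ≃ᵃⁱ[ℝ] Plane) (S : Set Plane) :
    volume.real (f '' S) = volume.real S := by
  rw [measureReal_def, measureReal_def,
    ← f.measurePreserving_plane.measure_preimage_equiv (f := f.toHomeomorph.toMeasurableEquiv) (f '' S)]
  congr 2
  exact f.injective.preimage_image S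

theorem exists_affineIsometryEquiv_normal {A B C : Plane} (h : doubleSignedArea A B C ≠ 0) :
    ∃ (f : Plane ≃ᵃⁱ[ℝ] Plane) (c k : ℝ), 0 < k ∧ f A = !₂[0, 0] ∧ f B = !₂[dist A B, 0] ∧
      f C = !₂[c, k] := by
  have hAB : 0 < dist A B := by
    refine dist_pos.2 fun e => h ?_
    rw [e, doubleSignedArea]
    ring
  -- The sign `σ` adds a reflection when needed to bring the third vertex into the upper half plane.
  obtain ⟨σ, hσ, hσh⟩ : ∃ σ : ℝ, σ ^ 2 = 1 ∧ 0 < σ * doubleSignedArea A B C := by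
    rcases lt_or_gt_of_ne h with h | h
    · exact ⟨-1, by norm_num, by linarith⟩
    · exact ⟨1, by norm_num, by linarith⟩
  have hd := Plane.dist_sq A B
  set L := dist A B with hL
  obtain ⟨a, ha⟩ : ∃ a, a = (B 0 - A 0) / L := ⟨_, rfl⟩
  obtain ⟨b, hb⟩ : ∃ b, b = (B 1 - A 1) / L := ⟨_, rfl⟩
  have hab : a ^ 2 + b ^ 2 = 1 := by
    rw [ha, hb]
    field_simp
    linarith
  let F : Plane →ₗᵢ[ℝ] Plane :=
    { toFun := fun v => !₂[a * v 0 + b * v 1, σ * (a * v 1 - b * v 0)]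
      map_add' := fun v w => by
        ext i
        fin_cases i <;> simp <;> ring
      map_smul' := fun m v => by
        ext i
        fin_cases i <;> simp <;> ring
      norm_map' := fun v => by
        simp only [LinearMap.coe_mk, AddHom.coe_mk, EuclideanSpace.norm_eq, Fin.sum_univ_two,
          Real.norm_eq_abs, sq_abs, Matrix.cons_val_zero, Matrix.cons_val_one]
        congr 1
        linear_combination (v 0 ^ 2 + v 1 ^ 2) * hab + (a * v 1 - b * v 0) ^ 2 * hσ }
  have hF : ∀ v, F v = !₂[a * v 0 + b * v 1, σ * (a * v 1 - b * v 0)] := fun v => rfl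
  refine ⟨(AffineIsometryEquiv.vaddConst ℝ A).symm.trans
    (F.toLinearIsometryEquiv rfl).toAffineIsometryEquiv, a * (C 0 - A 0) + b * (C 1 - A 1),
    σ * doubleSignedArea A B C / L, by positivity, ?_, ?_, ?_⟩
  · simp [hF]
  · simp only [AffineIsometryEquiv.coe_trans, Function.comp_apply,
      AffineIsometryEquiv.coe_vaddConst_symm, LinearIsometryEquiv.coe_toAffineIsometryEquiv,
      LinearIsometry.coe_toLinearIsometryEquiv, hF, vsub_eq_sub, PiLp.sub_apply]
    have e0 : a * (B 0 - A 0) + b * (B 1 - A 1) = L := by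
      rw [ha, hb]
      field_simp
      linarith
    have e1 : σ * (a * (B 1 - A 1) - b * (B 0 - A 0)) = 0 := by
      rw [ha, hb]
      field_simp
      ring
    rw [e0, e1]
  · simp only [AffineIsometryEquiv.coe_trans, Function.comp_apply,
      AffineIsometryEquiv.coe_vaddConst_symm, LinearIsometryEquiv.coe_toAffineIsometryEquiv,
      LinearIsometry.coe_toLinearIsometryEquiv, hF, vsub_eq_sub, PiLp.sub_apply]
    have e : σ * (a * (C 1 - A 1) - b * (C 0 - A 0)) = σ * doubleSignedArea A B C / L := by
      rw [ha, hb, doubleSignedArea]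
      field_simp
    rw [e]

/-- Parametrization of a positive slope by the tangent of half the angle. -/
theorem exists_halfAngleTangent {c h : ℝ} (hc : 0 < c) (hh : 0 < h) :
    ∃ t, 0 < t ∧ t < 1 ∧ c = h * ((1 - t ^ 2) / (2 * t)) := by
  have hs : √(c ^ 2 + h ^ 2) ^ 2 = c ^ 2 + h ^ 2 := Real.sq_sqrt (by positivity)
  have h1 : c < √(c ^ 2 + h ^ 2) := Real.lt_sqrt_of_sq_lt (by nlinarith)
  have h2 : √(c ^ 2 + h ^ 2) < c + h := by
    rw [Real.sqrt_lt' (by positivity)]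
    nlinarith
  -- This is `tan (θ / 2) = (1 - cos θ) / sin θ` for legs `c`, `h`.
  have ht : 0 < (√(c ^ 2 + h ^ 2) - c) / h := div_pos (by linarith) hh
  refine ⟨(√(c ^ 2 + h ^ 2) - c) / h, ht, (div_lt_one hh).2 (by linarith), ?_⟩
  have hne : √(c ^ 2 + h ^ 2) - c ≠ 0 := by linarith
  field_simp
  linear_combination hs

theorem Affine.Triangle.doubleSignedArea_ne_zero (T : Affine.Triangle ℝ Plane) :
    doubleSignedArea (T.points 0) (T.points 1) (T.points 2) ≠ 0 := by
  intro h
  have hp := T.inradius_mul_perimeter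
  rw [h, abs_zero] at hp
  have := T.inradius_pos
  have h01 : 0 < dist (T.points 0) (T.points 1) :=
    dist_pos.2 (T.independent.injective.ne (by decide))
  exact absurd hp (by positivity)

theorem Affine.Triangle.exists_perm_of_not_acuteAngled {T : Affine.Triangle ℝ Plane}
    (hT : ¬ T.AcuteAngled) : ∃ e : Equiv.Perm (Fin 3),
      dist ((T.reindex e).points 0) ((T.reindex e).points 2) ^ 2 +
        dist ((T.reindex e).points 1) ((T.reindex e).points 2) ^ 2 ≤
      dist ((T.reindex e).points 0) ((T.reindex e).points 1) ^ 2 := by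
  have key : ∀ A B C : Plane, Real.pi / 2 ≤ EuclideanGeometry.angle A C B →
      dist A C ^ 2 + dist B C ^ 2 ≤ dist A B ^ 2 := by
    intro A B C h
    have h1 := EuclideanGeometry.law_cos A C B
    have h2 := Real.cos_nonpos_of_pi_div_two_le_of_le h
      ((EuclideanGeometry.angle_le_pi A C B).trans (by linarith [Real.pi_pos]))
    have h3 : 0 ≤ dist A C * dist B C := by positivity
    nlinarith
  simp only [Affine.Triangle.acuteAngled_iff_angle_lt, not_and_or, not_lt] at hT
  rcases hT with h | h | h
  · exact ⟨Equiv.swap 1 2, key _ _ _ h⟩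
  · exact ⟨Equiv.swap 0 1, key _ _ _ h⟩
  · exact ⟨Equiv.swap 0 2, key _ _ _ h⟩

/-- Every right or obtuse triangle is congruent to one in normal position. -/
theorem Affine.Triangle.exists_normal_position {T : Affine.Triangle ℝ Plane}
    (hT : ¬ T.AcuteAngled) :
    ∃ (e : Equiv.Perm (Fin 3)) (f : Plane ≃ᵃⁱ[ℝ] Plane) (t u h : ℝ), 0 < t ∧ t < 1 ∧ 0 < u ∧
      u < 1 ∧ t + u + t * u ≤ 1 ∧ 0 < h ∧ f ((T.reindex e).points 0) = !₂[0, 0] ∧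
      f ((T.reindex e).points 1) =
        !₂[h * ((1 - t ^ 2) / (2 * t)) + h * ((1 - u ^ 2) / (2 * u)), 0] ∧
      f ((T.reindex e).points 2) = !₂[h * ((1 - t ^ 2) / (2 * t)), h] := by
  obtain ⟨e, he⟩ := exists_perm_of_not_acuteAngled hT
  obtain ⟨f, c, h, hh, h0, h1, h2⟩ :=
    exists_affineIsometryEquiv_normal (Affine.Triangle.doubleSignedArea_ne_zero (T.reindex e))
  set L := dist ((T.reindex e).points 0) ((T.reindex e).points 1)
  have hL : 0 < L := dist_pos.2 ((T.reindex e).independent.injective.ne (by decide))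
  rw [← f.dist_map, ← f.dist_map ((T.reindex e).points 1), h0, h1, h2, Plane.dist_sq,
    Plane.dist_sq] at he
  simp only [Matrix.cons_val_zero, Matrix.cons_val_one] at he
  -- A non-acute apex lies in the Thales disk over the base, so its altitude foot falls strictly
  -- inside the base.
  have hcL : h ^ 2 ≤ c * (L - c) := by linarith
  have hc : 0 < c := by nlinarith
  have hc' : 0 < L - c := by nlinarith
  obtain ⟨t, ht, ht1, hct⟩ := exists_halfAngleTangent hc hh
  obtain ⟨u, hu, hu1, hcu⟩ := exists_halfAngleTangent hc' hh
  refine ⟨e, f, t, u, h, ht, ht1, hu, hu1, ?_, hh, h0, ?_, ?_⟩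
  · have h3 : h ^ 2 * (4 * t * u) ≤ h ^ 2 * ((1 - t ^ 2) * (1 - u ^ 2)) := by
      rw [hcu, hct] at hcL
      calc h ^ 2 * (4 * t * u) ≤ (h * ((1 - t ^ 2) / (2 * t)) * (h * ((1 - u ^ 2) / (2 * u)))) *
            (4 * t * u) := by gcongr
        _ = _ := by field_simp; ring
    have h4 := le_of_mul_le_mul_left h3 (pow_pos hh 2)
    -- `(1 - t ^ 2) * (1 - u ^ 2) - 4 * t * u = (1 - t * u) ^ 2 - (t + u) ^ 2`.
    have h5 : t + u ≤ 1 - t * u := abs_le_of_sq_le_sq' (by linarith) (by nlinarith) |>.2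
    linarith
  · rw [← hcu, ← hct, h1]
    congr 2
    simp
  · rw [← hct, h2]

/-! ### From normal position to arbitrary triangles, and the density -/

theorem Affine.Triangle.packsAllOfArea_of_normal (T : Affine.Triangle ℝ Plane) {t u h : ℝ}
    (ht : 0 < t) (ht1 : t < 1) (hu : 0 < u) (hu1 : u < 1) (htu : t + u + t * u ≤ 1) (hh : 0 < h)
    (h0 : T.points 0 = !₂[0, 0])
    (h1 : T.points 1 = !₂[h * ((1 - t ^ 2) / (2 * t)) + h * ((1 - u ^ 2) / (2 * u)), 0])
    (h2 : T.points 2 = !₂[h * ((1 - t ^ 2) / (2 * t)), h]) :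
    PacksAllOfArea T.closedInterior (Real.pi * T.inradius ^ 2) ∧
    (∀ (P : Plane) (r : ℝ), 0 ≤ r → Metric.closedBall P r ⊆ T.closedInterior → r ≤ T.inradius) ∧
    volume.real T.closedInterior =
      |doubleSignedArea (T.points 0) (T.points 1) (T.points 2)| / 2 := by
  have ht2 : 0 < 1 - t ^ 2 := by nlinarith
  have hu2 : 0 < 1 - u ^ 2 := by nlinarith
  obtain ⟨L, hL⟩ : ∃ L, L = h * ((1 - t ^ 2) / (2 * t)) + h * ((1 - u ^ 2) / (2 * u)) := ⟨_, rfl⟩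
  rw [← hL] at h1
  have hLpos : 0 < L := by rw [hL]; positivity
  have hD : |doubleSignedArea (T.points 0) (T.points 1) (T.points 2)| = L * h := by
    rw [h0, h1, h2, doubleSignedArea]
    simp only [Matrix.cons_val_zero, Matrix.cons_val_one]
    rw [abs_of_nonneg (by nlinarith [mul_pos hLpos hh])]
    ring
  have dist_eq : ∀ (P Q : Plane) (d : ℝ), 0 ≤ d → (P 0 - Q 0) ^ 2 + (P 1 - Q 1) ^ 2 = d ^ 2 →
      dist P Q = d := by
    intro P Q d hd h
    rw [← Plane.dist_sq] at h
    exact (sq_eq_sq₀ dist_nonneg hd).1 h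
  have d12 : dist (T.points 1) (T.points 2) = h * ((1 + u ^ 2) / (2 * u)) := by
    apply dist_eq _ _ _ (by positivity)
    rw [h1, h2, hL]
    simp only [Matrix.cons_val_zero, Matrix.cons_val_one]
    field_simp
    ring
  have d20 : dist (T.points 2) (T.points 0) = h * ((1 + t ^ 2) / (2 * t)) := by
    apply dist_eq _ _ _ (by positivity)
    rw [h2, h0]
    simp only [Matrix.cons_val_zero, Matrix.cons_val_one]
    field_simp
    ring
  have d01 : dist (T.points 0) (T.points 1) = L := by
    apply dist_eq _ _ _ hLpos.le
    rw [h0, h1]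
    simp
  have hin : L = T.inradius * (1 / t + 1 / u) := by
    have hper := T.inradius_mul_perimeter
    rw [hD, d12, d20, d01] at hper
    have e : h * ((1 + u ^ 2) / (2 * u)) + h * ((1 + t ^ 2) / (2 * t)) + L =
        h * (1 / t + 1 / u) := by
      rw [hL]
      field_simp
      ring
    rw [e] at hper
    exact mul_right_cancel₀ hh.ne' (by linarith)
  have hball := fun P r => T.closedBall_subset_closedInterior_iff ht hu hLpos hh hL h0 h1 h2 P (r := r)
  refine ⟨fun n r hr hsum => ?_, fun P r hr hP => ?_, ?_⟩
  · have hsum' : ∑ i, r i ^ 2 ≤ T.inradius ^ 2 := by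
      rw [combinedArea, ← Finset.mul_sum] at hsum
      exact le_of_mul_le_mul_left hsum Real.pi_pos
    obtain ⟨x, y, hxy, hd⟩ :=
      trianglePacks_of_sum_sq_le r hr Finset.univ ht hu htu T.inradius_pos.le hsum'
    refine ⟨fun i => !₂[x i, y i], fun i => ?_, fun i j hij => Metric.ball_disjoint_ball ?_⟩
    · rw [hball _ _ (hr i).le, hin]
      exact hxy i (Finset.mem_univ i)
    · refine abs_le_of_sq_le_sq' ?_ dist_nonneg |>.2
      rw [Plane.dist_sq]
      exact hd i (Finset.mem_univ i) j (Finset.mem_univ j) hij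
  · rw [hball _ _ hr, hin] at hP
    exact hP.radius_le ht hu ht1 hu1
  · rw [hD, ← volume_triangle (c := h * ((1 - t ^ 2) / (2 * t))) hLpos hh]
    congr 1
    ext P
    exact T.mem_closedInterior_iff hLpos hh h0 h1 h2 P

/-- The double sum makes invariance under relabelling the vertices evident. -/
theorem Affine.Triangle.two_mul_perimeter (T : Affine.Triangle ℝ Plane) :
    2 * (dist (T.points 1) (T.points 2) + dist (T.points 2) (T.points 0) +
      dist (T.points 0) (T.points 1)) = ∑ i : Fin 3, ∑ j : Fin 3, dist (T.points i) (T.points j) := by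
  simp only [Fin.sum_univ_three, dist_self]
  rw [dist_comm (T.points 1) (T.points 0), dist_comm (T.points 2) (T.points 1),
    dist_comm (T.points 0) (T.points 2)]
  ring

/-- Packing, optimality of the incircle, and area, for right and obtuse triangles. -/
theorem Affine.Triangle.packsAllOfArea_of_not_acuteAngled {T : Affine.Triangle ℝ Plane}
    (hT : ¬ T.AcuteAngled) :
    PacksAllOfArea T.closedInterior (Real.pi * T.inradius ^ 2) ∧
    (∀ (P : Plane) (r : ℝ), 0 ≤ r → Metric.closedBall P r ⊆ T.closedInterior → r ≤ T.inradius) ∧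
    volume.real T.closedInterior =
      |doubleSignedArea (T.points 0) (T.points 1) (T.points 2)| / 2 := by
  obtain ⟨e, f, t, u, h, ht, ht1, hu, hu1, htu, hh, h0, h1, h2⟩ := exists_normal_position hT
  set T' : Affine.Triangle ℝ Plane :=
    (T.reindex e).map f.toAffineIsometry.toAffineMap f.toAffineIsometry.injective with hT'
  obtain ⟨c1, c2, c3⟩ := T'.packsAllOfArea_of_normal ht ht1 hu hu1 htu hh h0 h1 h2
  have hr : T'.inradius = T.inradius := by
    rw [hT', Affine.Simplex.inradius_map, Affine.Simplex.inradius_reindex]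
  have hi : T'.closedInterior = f '' T.closedInterior := by
    rw [hT', Affine.Simplex.closedInterior_map, Affine.Simplex.closedInterior_reindex]
    rfl
  rw [hr, hi] at c1
  rw [hr, hi] at c2
  -- The area is carried over as inradius times perimeter, both unchanged by relabelling and
  -- congruence, which avoids tracking orientation.
  rw [hi, volume_image_affineIsometryEquiv, ← T'.inradius_mul_perimeter, hr] at c3
  refine ⟨fun n r hr hsum => (c1 n r hr hsum).of_image f.toIsometryEquiv, fun P r hr hP => ?_, ?_⟩
  · refine c2 (f P) r hr ?_
    have himg : f '' Metric.closedBall P r = Metric.closedBall (f P) r :=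
      f.toIsometryEquiv.image_closedBall P r
    rw [← himg]
    exact Set.image_mono hP
  · rw [c3, ← T.inradius_mul_perimeter]
    have hper : ∑ i : Fin 3, ∑ j : Fin 3, dist (T'.points i) (T'.points j) =
        ∑ i : Fin 3, ∑ j : Fin 3, dist (T.points i) (T.points j) := by
      have : ∀ i j, dist (T'.points i) (T'.points j) =
          dist (T.points (e.symm i)) (T.points (e.symm j)) := fun i j => f.dist_map _ _
      simp_rw [this]
      rw [Equiv.sum_comp e.symm fun i => ∑ j, dist (T.points i) (T.points (e.symm j))]
      exact Finset.sum_congr rfl fun i _ => Equiv.sum_comp e.symm fun j => dist (T.points i) (T.points j)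
    rw [← T'.two_mul_perimeter, ← T.two_mul_perimeter] at hper
    rw [mul_left_cancel₀ two_ne_zero hper]

/-- Heron's formula. -/
theorem Affine.Triangle.heron (T : Affine.Triangle ℝ Plane) {x y z : ℝ}
    (hx : x = dist (T.points 1) (T.points 2)) (hy : y = dist (T.points 2) (T.points 0))
    (hz : z = dist (T.points 0) (T.points 1)) :
    (x + y - z) * (z + x - y) * (y + z - x) * (x + y + z) =
      4 * doubleSignedArea (T.points 0) (T.points 1) (T.points 2) ^ 2 := by
  have hx2 := Plane.dist_sq (T.points 1) (T.points 2)
  have hy2 := Plane.dist_sq (T.points 2) (T.points 0)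
  have hz2 := Plane.dist_sq (T.points 0) (T.points 1)
  rw [← hx] at hx2
  rw [← hy] at hy2
  rw [← hz] at hz2
  have e : (x + y - z) * (z + x - y) * (y + z - x) * (x + y + z) =
      2 * (x ^ 2 * y ^ 2 + y ^ 2 * z ^ 2 + z ^ 2 * x ^ 2) -
        ((x ^ 2) ^ 2 + (y ^ 2) ^ 2 + (z ^ 2) ^ 2) := by ring
  rw [e, hx2, hy2, hz2, doubleSignedArea]
  ring

theorem mainTheorem2 (T : Affine.Triangle ℝ Plane) (hT : ¬ T.AcuteAngled)
    (a : ℝ) (ha : a = Real.pi * T.inradius ^ 2)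
    (x y z : ℝ) (hx : x = dist (T.points 1) (T.points 2))
    (hy : y = dist (T.points 2) (T.points 0)) (hz : z = dist (T.points 0) (T.points 1)) :
    PacksAllOfArea T.closedInterior a ∧
    (∀ a' : ℝ, a < a' → ∃ (n : ℕ) (r : Fin n → ℝ), (∀ i, 0 < r i) ∧ combinedArea r = a' ∧
      ¬ CanBePackedInto r T.closedInterior) ∧
    IsCriticalDensity T.closedInterior
      (Real.pi * Real.sqrt ((x + y - z) * (z + x - y) * (y + z - x) / (x + y + z) ^ 3)) := by
  obtain ⟨hpack, hopt, hvol⟩ := Affine.Triangle.packsAllOfArea_of_not_acuteAngled hT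
  have hR := T.inradius_pos
  have htight : ∀ a' : ℝ, a < a' → ∃ (n : ℕ) (r : Fin n → ℝ), (∀ i, 0 < r i) ∧
      combinedArea r = a' ∧ ¬ CanBePackedInto r T.closedInterior := by
    intro a' haa'
    have ha0 : 0 ≤ a := by rw [ha]; positivity
    have hpos : 0 < a' / Real.pi := div_pos (ha0.trans_lt haa') Real.pi_pos
    -- A single disk larger than the incircle is the counterexample.
    refine ⟨1, fun _ => √(a' / Real.pi), fun _ => Real.sqrt_pos.2 hpos, ?_, ?_⟩
    · rw [combinedArea, Fin.sum_univ_one, Real.sq_sqrt hpos.le]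
      field_simp
    · rintro ⟨c, hc, -⟩
      have h := hopt _ _ (Real.sqrt_nonneg _) (hc 0)
      rw [Real.sqrt_le_left hR.le, div_le_iff₀ Real.pi_pos] at h
      linarith
  refine ⟨ha ▸ hpack, htight, a, ⟨ha ▸ hpack, fun a' ha' => ?_⟩, ?_⟩
  · by_contra! hlt
    obtain ⟨n, r, hr, hsum, hnot⟩ := htight a' hlt
    exact hnot (ha' n r hr hsum.le)
  · have hper := T.inradius_mul_perimeter
    have hheron := T.heron hx hy hz
    rw [← sq_abs, ← hper, ← hx, ← hy, ← hz] at hheron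
    rw [hvol, ← hper, ← hx, ← hy, ← hz, ha]
    have hP : 0 < x + y + z := by
      have : 0 < z := hz ▸ dist_pos.2 (T.independent.injective.ne (by decide))
      have : 0 ≤ x := hx ▸ dist_nonneg
      have : 0 ≤ y := hy ▸ dist_nonneg
      linarith
    -- The density is `2 * π * R / P` with `P` the perimeter, and Heron's product of three factors
    -- equals `4 * R ^ 2 * P`.
    have hsq : (x + y - z) * (z + x - y) * (y + z - x) / (x + y + z) ^ 3 =
        (2 * T.inradius / (x + y + z)) ^ 2 := by
      rw [div_pow, div_eq_div_iff (by positivity) (by positivity)]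
      linear_combination (x + y + z) * hheron
    rw [hsq, Real.sqrt_sq (by positivity)]
    field_simp
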